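/- Let $k$ be a local field (a locally compact, non-discrete topological field) of characteristic $p>0$. Let $X$ and $Y$ be second countable analytic manifolds over $k$ of dimensions $m$ and $r$ respectively, and let $f\colon X\to Y$ be an analytic map. Let $$C=\{x\in X : df_x\colon T_xX\to T_{f(x)}Y \text{ is not surjective}\}$$ be the critical set of $f$. If $p>m-r+1$, then $f(C)$ has measure zero in $Y$; that is, for every analytic chart $\varphi\colon U\to k^r$ of $Y$ the set $\varphi(f(C)\cap U)$ is a null set for Haar measure on $k^r$. -/

import Mathlib

open scoped Manifold ContDiff

/-- The critical set of a map `f : X → Y` of analytic manifolds over `k` of dimensions `m` and `r`: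
the points at which the differential `T_x X → T_{f x} Y` is not surjective. Equivalently, the
differentials at `x` of the `r` components of `f` in local coordinates are linearly dependent. -/
def criticalSet (k : Type*) [NontriviallyNormedField k] (m r : ℕ)
    {X : Type*} [TopologicalSpace X] [ChartedSpace (Fin m → k) X]
    {Y : Type*} [TopologicalSpace Y] [ChartedSpace (Fin r → k) Y]
    (f : X → Y) : Set X :=
  {x | ¬ Function.Surjective (mfderiv 𝓘(k, Fin m → k) 𝓘(k, Fin r → k) f x)}

/-- A subset `S` of an `r`-dimensional analytic manifold `Y` over `k` has measure zero if its image
in `k ^ r` under every analytic chart of `Y` is null for (every) Haar measure of `k ^ r`. -/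
def HasMeasureZero (k : Type*) [NontriviallyNormedField k] [MeasurableSpace k] (r : ℕ)
    {Y : Type*} [TopologicalSpace Y] [ChartedSpace (Fin r → k) Y] (S : Set Y) : Prop :=
  ∀ e ∈ IsManifold.maximalAtlas 𝓘(k, Fin r → k) ω Y,
    ∀ μ : MeasureTheory.Measure (Fin r → k), μ.IsAddHaarMeasure → μ (e '' (S ∩ e.source)) = 0

/-! In charts, induct on the dimension of the source and split the critical set by the first
derivative that does not vanish. Where `df ≠ 0`, a component of `f` becomes a coordinate; each slice
loses one variable and one component, so `m - r` is unchanged, and Fubini concludes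
(`piHaar_image_critical_fderiv_ne_zero`). Where `df = 0` but a higher derivative survives, the
points lie locally on a hypersurface, to which `f` restricts with zero differential there
(`piHaar_image_iteratedFDeriv_eq_zero_succ_ne_zero`).

There remain points where every derivative vanishes. In characteristic `p` this kills the Taylor
terms only in degrees `1, …, p - 1`, since `i!` is invertible only for `i < p`. So `f` varies to
order `p`, balls of radius `ρ` go into balls of radius `O(ρ ^ p)`, and a cover by disjoint balls
gives a null image once `m < p * r` (`piHaar_image_eq_zero_of_isBigO`). The bound on `p` ensures
this for `1 ≤ r ≤ m`; for `r > m` order one is enough. -/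

open MeasureTheory Set Filter Topology Metric Asymptotics
open scoped ENNReal NNReal Pointwise

/-! ### Haar measure estimates on `k ^ r` -/

section Measure

variable {k : Type*} [NontriviallyNormedField k] [ProperSpace k] [MeasurableSpace k] [BorelSpace k]

/-- The Haar measure of `k ^ r` obtained as a product of Haar measures of `k`. -/
noncomputable abbrev piHaar (k : Type*) [NontriviallyNormedField k] [ProperSpace k]
    [MeasurableSpace k] [BorelSpace k] (r : ℕ) : Measure (Fin r → k) :=
  Measure.pi fun _ : Fin r => (Measure.addHaar : Measure k)

variable (k) in
/-- Haar measure of small balls of an ultrametric local field decays geometrically. -/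
theorem exists_addHaar_closedBall_pow [IsUltrametricDist k] :
    ∃ t : k, 0 < ‖t‖ ∧ ‖t‖ < 1 ∧ ∃ δ : ℝ≥0, 0 < δ ∧ δ < 1 ∧ ∀ n : ℕ,
      (Measure.addHaar : Measure k) (closedBall 0 (‖t‖ ^ n)) =
        δ ^ n * (Measure.addHaar : Measure k) (closedBall 0 1) := by
  obtain ⟨t, ht0, ht1⟩ := NormedField.exists_norm_lt_one k
  have ht : t ≠ 0 := norm_pos_iff.1 ht0
  let u : kˣ := Units.mk0 t ht
  have hball (n : ℕ) : closedBall (0 : k) (‖t‖ ^ n) = (u ^ n) • closedBall (0 : k) 1 := by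
    have : (u ^ n) • closedBall (0 : k) 1 = (t ^ n) • closedBall (0 : k) 1 := by
      ext x; simp [u, Set.mem_smul_set, Units.smul_def]
    rw [this, _root_.smul_closedBall _ _ zero_le_one]
    simp
  have hformula (n : ℕ) : (Measure.addHaar : Measure k) (closedBall 0 (‖t‖ ^ n)) =
      ((distribHaarChar k u) ^ n : ℝ≥0) * (Measure.addHaar : Measure k) (closedBall 0 1) := by
    rw [hball, ← distribHaarChar_mul, map_pow]
  refine ⟨t, ht0, ht1, distribHaarChar k u, distribHaarChar_pos, ?_, fun n => by
    rw [hformula n]; push_cast; rfl⟩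
  -- The open unit ball around `1` has positive measure and contains only elements of norm `1`, so
  -- it is lost on shrinking to radius `‖t‖`.
  have hlt : (Measure.addHaar : Measure k) (closedBall 0 ‖t‖) <
      (Measure.addHaar : Measure k) (closedBall 0 1) := by
    have hsub : ball (1 : k) 1 ⊆ closedBall 0 1 \ closedBall 0 ‖t‖ := by
      intro x hx
      have hx1 : ‖x‖ = 1 := by
        have hlt : ‖x - 1‖ < ‖(1 : k)‖ := by simpa [dist_eq_norm] using hx
        have hmax := IsUltrametricDist.norm_add_eq_max_of_norm_ne_norm hlt.ne
        rwa [sub_add_cancel, max_eq_right hlt.le, norm_one] at hmax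
      simp [hx1, ht1]
    have h1 : (Measure.addHaar : Measure k) (closedBall 0 1) =
        (Measure.addHaar : Measure k) (closedBall 0 ‖t‖) +
          (Measure.addHaar : Measure k) (closedBall 0 1 \ closedBall 0 ‖t‖) := by
      rw [measure_add_sdiff isClosed_closedBall.measurableSet.nullMeasurableSet,
        union_eq_right.2 (closedBall_subset_closedBall ht1.le)]
    rw [h1]
    refine ENNReal.lt_add_right measure_closedBall_lt_top.ne ?_
    exact ((measure_ball_pos _ _ zero_lt_one).trans_le (measure_mono hsub)).ne'
  have h2 := hformula 1
  rw [pow_one, pow_one] at h2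
  by_contra! hge
  rw [h2] at hlt
  refine absurd hlt (not_lt.2 ?_)
  calc (Measure.addHaar : Measure k) (closedBall 0 1)
      = 1 * (Measure.addHaar : Measure k) (closedBall 0 1) := (one_mul _).symm
    _ ≤ _ := by gcongr; exact_mod_cast hge

theorem piHaar_closedBall {r : ℕ} (x : Fin r → k) {ρ : ℝ} (hρ : 0 ≤ ρ) :
    piHaar k r (closedBall x ρ) = (Measure.addHaar : Measure k) (closedBall 0 ρ) ^ r := by
  rw [closedBall_pi _ hρ, Measure.pi_pi]
  simp [Measure.addHaar_closedBall_center]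

/-- The image of a bounded set under a map satisfying a uniform estimate
`‖f x - f y‖ ≤ C ‖x - y‖ ^ d` at small scales is null when `m < d * r`. -/
theorem piHaar_image_eq_zero_of_uniform [IsUltrametricDist k] {m r d : ℕ} (h : m < d * r)
    {f : (Fin m → k) → (Fin r → k)} {S : Set (Fin m → k)} {R C ε : ℝ} (hε : 0 < ε)
    (hS : S ⊆ closedBall 0 R)
    (hf : ∀ x ∈ S, ∀ y, dist y x < ε → ‖f y - f x‖ ≤ C * ‖y - x‖ ^ d) :
    piHaar k r (f '' S) = 0 := by
  obtain ⟨t, ht0, ht1, δ, hδ0, hδ1, hδ⟩ := exists_addHaar_closedBall_pow k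
  set V := (Measure.addHaar : Measure k) (closedBall 0 1) with hV
  have hV0 : V ≠ 0 := (measure_closedBall_pos _ _ zero_lt_one).ne'
  have hVt : V ≠ ⊤ := measure_closedBall_lt_top.ne
  -- The constant `C` is traded for a shift `a` of the exponent, costing a fixed factor `δ ^ (-a *
  -- r)`.
  obtain ⟨a, ha⟩ : ∃ a : ℕ, C * ‖t‖ ^ a ≤ 1 := by
    have : Tendsto (fun a : ℕ => C * ‖t‖ ^ a) atTop (𝓝 (C * 0)) :=
      (tendsto_pow_atTop_nhds_zero_of_lt_one ht0.le ht1).const_mul C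
    rw [mul_zero] at this
    exact (this.eventually (ge_mem_nhds zero_lt_one)).exists
  -- the estimate at scale `‖t‖ ^ n`
  have key : ∀ᶠ n : ℕ in atTop, piHaar k r (f '' S) ≤
      (δ : ℝ≥0∞) ^ (n - a * r) * (V ^ r / V ^ m) * piHaar k m (closedBall 0 (max R 1)) := by
    have hsm : ∀ᶠ n : ℕ in atTop, ‖t‖ ^ n < ε :=
      (tendsto_pow_atTop_nhds_zero_of_lt_one ht0.le ht1).eventually (gt_mem_nhds hε)
    filter_upwards [hsm, eventually_ge_atTop a, eventually_ge_atTop (a * r)] with n hnε hna hnar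
    set ρ := ‖t‖ ^ n with hρ
    have hρ0 : 0 < ρ := pow_pos ht0 n
    have hρ1 : ρ ≤ 1 := pow_le_one₀ ht0.le ht1.le
    -- Taken as sets, ultrametric balls of equal radius are disjoint, so their measures add up
    -- without any covering lemma.
    let 𝓕 : Set (Set (Fin m → k)) := (fun x => closedBall x ρ) '' S
    have hdisj : 𝓕.Pairwise Disjoint := by
      rintro _ ⟨x, _, rfl⟩ _ ⟨y, _, rfl⟩ hne
      exact (IsUltrametricDist.closedBall_eq_or_disjoint x y ρ).resolve_left hne
    have hcount : 𝓕.Countable := by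
      refine Set.PairwiseDisjoint.countable_of_isOpen (s := id) (fun a ha b hb hab =>
        hdisj ha hb hab) ?_ ?_
      · rintro _ ⟨x, _, rfl⟩
        exact IsUltrametricDist.isOpen_closedBall x hρ0.ne'
      · rintro _ ⟨x, _, rfl⟩
        exact ⟨x, mem_closedBall_self hρ0.le⟩
    have hmeas : ∀ B ∈ 𝓕, MeasurableSet B := by
      rintro _ ⟨x, _, rfl⟩
      exact isClosed_closedBall.measurableSet
    have hcov : f '' S ⊆ ⋃ B ∈ 𝓕, f '' (S ∩ B) := by
      rintro _ ⟨x, hx, rfl⟩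
      exact mem_biUnion (mem_image_of_mem _ hx) ⟨x, ⟨hx, mem_closedBall_self hρ0.le⟩, rfl⟩
    have hunion : ⋃₀ 𝓕 ⊆ closedBall 0 (max R 1) := by
      rintro z ⟨_, ⟨x, hx, rfl⟩, hz⟩
      have h1 : dist z x ≤ max R 1 := (mem_closedBall.1 hz).trans (hρ1.trans (le_max_right _ _))
      have h2 : dist x 0 ≤ max R 1 := (mem_closedBall.1 (hS hx)).trans (le_max_left _ _)
      exact (dist_triangle_max z x 0).trans (max_le h1 h2)
    have hterm : ∀ B ∈ 𝓕, piHaar k r (f '' (S ∩ B)) ≤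
        (δ : ℝ≥0∞) ^ (n - a * r) * (V ^ r / V ^ m) * piHaar k m B := by
      rintro _ ⟨x, hx, rfl⟩
      have hd : 0 < d := Nat.pos_of_ne_zero (by rintro rfl; simp at h)
      have hle : a ≤ n * d := hna.trans (Nat.le_mul_of_pos_right _ hd)
      have hsub : f '' (S ∩ closedBall x ρ) ⊆ closedBall (f x) (‖t‖ ^ (n * d - a)) := by
        rintro _ ⟨y, ⟨_, hy⟩, rfl⟩
        have hy' : ‖y - x‖ ≤ ρ := by simpa [dist_eq_norm] using hy
        rw [mem_closedBall, dist_eq_norm]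
        have h1 := hf x hx y (lt_of_le_of_lt hy hnε)
        rcases le_or_gt C 0 with hC | hC
        · exact (h1.trans (mul_nonpos_of_nonpos_of_nonneg hC (by positivity))).trans (by positivity)
        calc ‖f y - f x‖ ≤ C * ρ ^ d := h1.trans (by gcongr)
          _ = (C * ‖t‖ ^ a) * ‖t‖ ^ (n * d - a) := by
              rw [hρ, ← pow_mul, mul_assoc, ← pow_add, Nat.add_sub_cancel' hle]
          _ ≤ 1 * ‖t‖ ^ (n * d - a) := by gcongr
          _ = _ := one_mul _
      refine (measure_mono hsub).trans ?_
      rw [piHaar_closedBall _ (by positivity), piHaar_closedBall _ hρ0.le, hδ, hρ, hδ, mul_pow,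
        mul_pow]
      -- Since `m + 1 ≤ d * r`, a factor `δ ^ n` is left over after `δ ^ (n * m)` pays for the
      -- source ball.
      have hexp : n - a * r + n * m ≤ (n * d - a) * r := by
        rw [Nat.sub_mul]
        have : n * (m + 1) ≤ n * (d * r) := Nat.mul_le_mul_left n h
        have h3 : n * d * r = n * (d * r) := Nat.mul_assoc ..
        have h4 : n * (m + 1) = n * m + n := by ring
        omega
      have hVm : V ^ m ≠ 0 := pow_ne_zero _ hV0
      have hVm' : V ^ m ≠ ⊤ := ENNReal.pow_ne_top hVt
      calc ((δ : ℝ≥0∞) ^ (n * d - a)) ^ r * V ^ r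
          = (δ : ℝ≥0∞) ^ ((n * d - a) * r) * V ^ r := by rw [pow_mul]
        _ ≤ (δ : ℝ≥0∞) ^ (n - a * r + n * m) * V ^ r := by
            gcongr ?_ * _
            exact pow_le_pow_right_of_le_one' (by exact_mod_cast hδ1.le) hexp
        _ = (δ : ℝ≥0∞) ^ (n - a * r) * (V ^ r / V ^ m) * (((δ : ℝ≥0∞) ^ n) ^ m * V ^ m) := by
            have : V ^ r = V ^ r / V ^ m * V ^ m := (ENNReal.div_mul_cancel hVm hVm').symm
            rw [pow_add, pow_mul]
            conv_lhs => rw [this]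
            ring
    calc piHaar k r (f '' S) ≤ piHaar k r (⋃ B ∈ 𝓕, f '' (S ∩ B)) := measure_mono hcov
      _ ≤ ∑' B : 𝓕, piHaar k r (f '' (S ∩ B)) := measure_biUnion_le _ hcount _
      _ ≤ ∑' B : 𝓕, (δ : ℝ≥0∞) ^ (n - a * r) * (V ^ r / V ^ m) * piHaar k m B :=
          ENNReal.tsum_le_tsum fun B => hterm B B.2
      _ = (δ : ℝ≥0∞) ^ (n - a * r) * (V ^ r / V ^ m) * piHaar k m (⋃₀ 𝓕) := by
          rw [ENNReal.tsum_mul_left, measure_sUnion hcount hdisj hmeas]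
      _ ≤ _ := by gcongr
  have hlim : Tendsto (fun n : ℕ => (δ : ℝ≥0∞) ^ (n - a * r) * (V ^ r / V ^ m) *
      piHaar k m (closedBall 0 (max R 1))) atTop (𝓝 0) := by
    have h1 : Tendsto (fun n : ℕ => (δ : ℝ≥0∞) ^ (n - a * r)) atTop (𝓝 0) :=
      (ENNReal.tendsto_pow_atTop_nhds_zero_of_lt_one (by exact_mod_cast hδ1)).comp
        (tendsto_sub_atTop_nat _)
    have hc : V ^ r / V ^ m ≠ ⊤ :=
      ENNReal.div_ne_top (ENNReal.pow_ne_top hVt) (pow_ne_zero _ hV0)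
    have hb : piHaar k m (closedBall 0 (max R 1)) ≠ ⊤ := measure_closedBall_lt_top.ne
    have h2 := ENNReal.Tendsto.mul_const (b := V ^ r / V ^ m * piHaar k m (closedBall 0 (max R 1)))
      h1 (Or.inr (ENNReal.mul_ne_top hc hb))
    simpa [mul_assoc] using h2
  exact le_antisymm (ge_of_tendsto hlim key) bot_le

/-- If `f` varies to order `d` at every point of `S ⊆ k ^ m`, then `f '' S` is null in `k ^ r`
when `m < d * r`. -/
theorem piHaar_image_eq_zero_of_isBigO [IsUltrametricDist k] {m r d : ℕ} (h : m < d * r)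
    {f : (Fin m → k) → (Fin r → k)} {S : Set (Fin m → k)}
    (hf : ∀ x ∈ S, (fun y => f y - f x) =O[𝓝 x] fun y => ‖y - x‖ ^ d) :
    piHaar k r (f '' S) = 0 := by
  -- One `N` bounds the norm, the constant and the inverse scale; countably many such sets exhaust
  -- `S`.
  let T (N : ℕ) : Set (Fin m → k) := {x | x ∈ closedBall 0 (N : ℝ) ∧
    ∀ y, dist y x < 1 / ((N : ℝ) + 1) → ‖f y - f x‖ ≤ N * ‖y - x‖ ^ d}
  have hcov : f '' S ⊆ ⋃ N, f '' T N := by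
    rintro _ ⟨x, hx, rfl⟩
    obtain ⟨C, hC⟩ := (hf x hx).bound
    obtain ⟨ε, hε, hball⟩ := Metric.eventually_nhds_iff.1 hC
    obtain ⟨N₁, hN₁⟩ := exists_nat_one_div_lt hε
    obtain ⟨N₂, hN₂⟩ := exists_nat_ge (max C ‖x‖)
    refine mem_iUnion.2 ⟨max N₁ N₂, x, ⟨?_, fun y hy => ?_⟩, rfl⟩
    · have : (N₂ : ℝ) ≤ (max N₁ N₂ : ℕ) := by exact_mod_cast le_max_right _ _
      simpa using ((le_max_right _ _).trans hN₂).trans this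
    · have h1 : (N₁ : ℝ) ≤ (max N₁ N₂ : ℕ) := by exact_mod_cast le_max_left _ _
      have h2 : (N₂ : ℝ) ≤ (max N₁ N₂ : ℕ) := by exact_mod_cast le_max_right _ _
      have h3 : 1 / (((max N₁ N₂ : ℕ) : ℝ) + 1) ≤ 1 / ((N₁ : ℝ) + 1) := by gcongr
      have h4 := hball ((hy.trans_le h3).trans hN₁)
      rw [norm_pow, norm_norm] at h4
      refine h4.trans ?_
      gcongr
      exact ((le_max_left _ _).trans hN₂).trans h2
  refine measure_mono_null hcov (measure_iUnion_null fun N => ?_)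
  exact piHaar_image_eq_zero_of_uniform h (R := N) (C := N) (ε := 1 / ((N : ℝ) + 1))
    (by positivity) (fun x hx => hx.1) fun x hx => hx.2

/-- A set has null image if it is locally so. -/
theorem measure_image_null_of_locally {α β : Type*} [TopologicalSpace α]
    [SecondCountableTopology α] [MeasurableSpace β] {μ : Measure β} {f : α → β} {S : Set α}
    (h : ∀ x ∈ S, ∃ U ∈ 𝓝 x, μ (f '' (S ∩ U)) = 0) : μ (f '' S) = 0 := by
  choose! U hU hμ using h
  obtain ⟨t, htS, htc, hcov⟩ := TopologicalSpace.countable_cover_nhdsWithin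
    (fun x hx => mem_nhdsWithin_of_mem_nhds (hU x hx))
  have : f '' S ⊆ ⋃ x ∈ t, f '' (S ∩ U x) := by
    rintro _ ⟨x, hx, rfl⟩
    obtain ⟨y, hy, hxy⟩ := mem_iUnion₂.1 (hcov hx)
    exact mem_biUnion hy ⟨x, ⟨hx, hxy⟩, rfl⟩
  exact measure_mono_null this ((measure_biUnion_null_iff htc).2 fun x hx => hμ x (htS hx))

/-- The continuous image of a difference of open sets in a proper space is Borel. -/
theorem measurableSet_image_sdiff_of_isOpen {α β : Type*} [MetricSpace α] [ProperSpace α]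
    [TopologicalSpace β] [T2Space β] [MeasurableSpace β] [BorelSpace β] {g : α → β} {T O : Set α}
    (hT : IsOpen T) (hO : IsOpen O) (hg : ContinuousOn g T) : MeasurableSet (g '' (T \ O)) := by
  obtain ⟨F, hFc, hFT, hFU, -⟩ := hT.exists_iUnion_isClosed
  have : g '' (T \ O) = ⋃ n, ⋃ j, g '' (compactCovering α j ∩ (F n \ O)) := by
    rw [← hFU, iUnion_sdiff, image_iUnion]
    refine iUnion_congr fun n => ?_
    rw [← image_iUnion, ← iUnion_inter, iUnion_compactCovering, univ_inter]
  rw [this]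
  refine MeasurableSet.iUnion fun n => MeasurableSet.iUnion fun j => ?_
  have hc : IsCompact (compactCovering α j ∩ (F n \ O)) :=
    (isCompact_compactCovering α j).inter_right ((hFc n).sdiff hO)
  exact (hc.image_of_continuousOn (hg.mono fun x hx => hFT n hx.2.1)).measurableSet

/-- Fubini's criterion for a Borel subset of `k ^ (s + 1)` to be null. -/
theorem piHaar_eq_zero_of_slices {s : ℕ} (l : Fin (s + 1)) {A : Set (Fin (s + 1) → k)}
    (hA : MeasurableSet A)
    (h : ∀ c : k, piHaar k s {y | l.insertNth c y ∈ A} = 0) : piHaar k (s + 1) A = 0 := by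
  have hmp := (measurePreserving_piFinSuccAbove
    (fun _ : Fin (s + 1) => (Measure.addHaar : Measure k)) l).symm
  rw [← hmp.measure_preimage hA.nullMeasurableSet,
    Measure.measure_prod_null (hmp.measurable hA)]
  exact Eventually.of_forall fun c => h c

end Measure

/-! ### Taylor expansions and analytic coordinates -/

section Analytic

variable {k : Type*} [NontriviallyNormedField k]

/-- The inclusion of `k ^ n` as the hyperplane of `k ^ (n + 1)` where the first coordinate is `0`. -/
def consZeroL (k : Type*) [NontriviallyNormedField k] (n : ℕ) :
    (Fin n → k) →L[k] (Fin (n + 1) → k) :=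
  ContinuousLinearMap.pi (Fin.cons 0 fun i => ContinuousLinearMap.proj i)

theorem consZeroL_apply {n : ℕ} (v : Fin n → k) : consZeroL k n v = Fin.cons 0 v := by
  ext i
  refine Fin.cases ?_ (fun i => ?_) i <;> simp [consZeroL]

theorem cons_eq_consZeroL_add {n : ℕ} (c : k) (v : Fin n → k) :
    (Fin.cons c v : Fin (n + 1) → k) = consZeroL k n v + Fin.cons c 0 := by
  rw [consZeroL_apply]
  ext i
  refine Fin.cases ?_ (fun i => ?_) i <;> simp

theorem analyticAt_finCons {n : ℕ} (c : k) (y : Fin n → k) :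
    AnalyticAt k (fun v : Fin n → k => (Fin.cons c v : Fin (n + 1) → k)) y := by
  rw [funext (cons_eq_consZeroL_add c)]
  exact ((consZeroL k n).analyticAt y).add analyticAt_const

theorem hasFDerivAt_finCons_const {n : ℕ} (c : k) (y : Fin n → k) :
    HasFDerivAt (fun v : Fin n → k => (Fin.cons c v : Fin (n + 1) → k)) (consZeroL k n) y := by
  rw [funext (cons_eq_consZeroL_add c)]
  exact (consZeroL k n).hasFDerivAt.add_const _

/-- In characteristic `p`, if the derivatives of orders `1, …, p - 1` of an analytic function vanish
at `x`, the function varies to order `p` at `x`. -/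
theorem AnalyticAt.isBigO_sub_pow_of_iteratedFDeriv_eq_zero {p : ℕ} (hp : p.Prime) [CharP k p]
    {E F : Type*} [NormedAddCommGroup E] [NormedSpace k E] [NormedAddCommGroup F]
    [NormedSpace k F] [CompleteSpace F] {f : E → F} {x : E} (hf : AnalyticAt k f x)
    (h : ∀ i, 1 ≤ i → i < p → iteratedFDeriv k i f x = 0) :
    (fun y => f y - f x) =O[𝓝 x] fun y => ‖y - x‖ ^ p := by
  obtain ⟨P, hP⟩ := hf
  obtain ⟨ρ, hρ⟩ := id hP
  have hterm (y : E) (i : ℕ) (h1 : 1 ≤ i) (hi : i < p) : P i (fun _ => y) = 0 := by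
    have h2 := hρ.factorial_smul y i
    rw [h i h1 hi, zero_apply, ← Nat.cast_smul_eq_nsmul k] at h2
    -- Here `i < p` is essential: `p` does not divide `i!`.
    refine (smul_eq_zero.1 h2).resolve_left fun h3 => ?_
    rw [CharP.cast_eq_zero_iff k p, hp.dvd_factorial] at h3
    omega
  have hsum (y : E) : P.partialSum p y = f x := by
    rw [FormalMultilinearSeries.partialSum, Finset.sum_eq_single 0]
    · exact hP.coeff_zero _
    · intro i hi h0
      exact hterm y i (Nat.one_le_iff_ne_zero.2 h0) (Finset.mem_range.1 hi)
    · intro h0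
      exact absurd (Finset.mem_range.2 hp.pos) h0
  have hO := hP.isBigO_sub_partialSum_pow p
  simp only [hsum] at hO
  have hlim : Tendsto (fun y => y - x) (𝓝 x) (𝓝 0) := by
    have : Tendsto (fun y => y - x) (𝓝 x) (𝓝 (x - x)) := tendsto_id.sub tendsto_const_nhds
    rwa [sub_self] at this
  simpa [Function.comp_def] using hO.comp_tendsto hlim

variable [CompleteSpace k]

/-- If `R` is a right inverse of `L₀`, then `L ∘ R` stays invertible for `L` near `L₀`. This makes
critical sets relatively closed, as needed for measurability. -/
theorem isOpen_setOf_surjective_continuousLinearMap {E F : Type*} [NormedAddCommGroup E]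
    [NormedSpace k E] [NormedAddCommGroup F] [NormedSpace k F] [FiniteDimensional k F] :
    IsOpen {L : E →L[k] F | Function.Surjective L} := by
  have : CompleteSpace F := FiniteDimensional.complete k F
  rw [isOpen_iff_mem_nhds]
  intro L₀ hL₀
  obtain ⟨R, hR⟩ := (L₀ : E →ₗ[k] F).exists_rightInverse_of_surjective
    (LinearMap.range_eq_top.2 hL₀)
  have hcont : Continuous fun L : E →L[k] F => L.comp (LinearMap.toContinuousLinearMap R) :=
    continuous_id.clm_comp continuous_const
  have hone : L₀.comp (LinearMap.toContinuousLinearMap R) = 1 := by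
    ext x
    exact LinearMap.congr_fun hR x
  have hev : ∀ᶠ L in 𝓝 L₀, IsUnit (L.comp (LinearMap.toContinuousLinearMap R)) := by
    refine hcont.continuousAt.eventually (Units.isOpen.mem_nhds ?_)
    simp only [mem_ofPred_eq, hone, isUnit_one]
  filter_upwards [hev] with L hL
  obtain ⟨u, hu⟩ := hL
  intro y
  refine ⟨R ((↑u⁻¹ : F →L[k] F) y), ?_⟩
  have h1 : (L.comp (LinearMap.toContinuousLinearMap R)) ((↑u⁻¹ : F →L[k] F) y) = y := by
    rw [← hu, ← mul_apply_eq_comp, Units.mul_inv, one_apply_eq_self]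
  exact h1

/-- A nonzero differential of `w` lets one use `w` as first coordinate: `φ` is a local
analytic parametrization in which `w` becomes the coordinate `z 0`. -/
theorem exists_analytic_parametrization {n : ℕ} {w : (Fin (n + 1) → k) → k} {x₀ : Fin (n + 1) → k}
    (hw : AnalyticAt k w x₀) (hdw : fderiv k w x₀ ≠ 0) {U : Set (Fin (n + 1) → k)}
    (hU : U ∈ 𝓝 x₀) :
    ∃ (φ : (Fin (n + 1) → k) → (Fin (n + 1) → k)) (T : Set (Fin (n + 1) → k)),
      IsOpen T ∧ AnalyticOnNhd k φ T ∧ MapsTo φ T U ∧ (∀ z ∈ T, w (φ z) = z 0) ∧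
        ∀ᶠ x in 𝓝 x₀, ∃ z ∈ T, φ z = x := by
  obtain ⟨j, hj⟩ : ∃ j, fderiv k w x₀ (Pi.single j 1) ≠ 0 := by
    by_contra! hcon
    refine hdw (ContinuousLinearMap.coe_injective (LinearMap.pi_ext' fun i => ?_))
    ext
    simpa using hcon i
  -- Put `w` first and drop coordinate `j`, along which `w` has nonzero derivative; `φ` is the local
  -- inverse.
  let Ψ : (Fin (n + 1) → k) → (Fin (n + 1) → k) :=
    fun x => Fin.cons (w x) fun i => x (j.succAbove i)
  have hproj (i : Fin (n + 1)) : AnalyticAt k (fun x : Fin (n + 1) → k => x i) x₀ :=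
    (ContinuousLinearMap.proj (R := k) (φ := fun _ : Fin (n + 1) => k) i).analyticAt x₀
  have hΨ : AnalyticAt k Ψ x₀ := by
    refine analyticAt_pi_iff.2 fun i => ?_
    refine Fin.cases ?_ (fun i => ?_) i
    · exact hw
    · exact hproj _
  let A := fderiv k Ψ x₀
  have hA : HasFDerivAt Ψ A x₀ := hΨ.differentiableAt.hasFDerivAt
  have hA0 (v) : A v 0 = fderiv k w x₀ v := by
    have h1 : HasFDerivAt w ((ContinuousLinearMap.proj 0).comp A) x₀ := hasFDerivAt_pi'.1 hA 0
    rw [h1.fderiv]; rfl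
  have hAs (v) (i : Fin n) : A v i.succ = v (j.succAbove i) := by
    have h1 : HasFDerivAt (fun x : Fin (n + 1) → k => x (j.succAbove i))
      ((ContinuousLinearMap.proj i.succ).comp A) x₀ := hasFDerivAt_pi'.1 hA i.succ
    have h2 : HasFDerivAt (fun x : Fin (n + 1) → k => x (j.succAbove i))
      (ContinuousLinearMap.proj (R := k) (φ := fun _ : Fin (n + 1) => k) (j.succAbove i)) x₀ :=
      (ContinuousLinearMap.proj (R := k) (φ := fun _ : Fin (n + 1) => k)
        (j.succAbove i)).hasFDerivAt
    exact congrArg (fun L => L v) (h1.unique h2)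
  have hinj : Function.Injective (A : (Fin (n + 1) → k) →ₗ[k] (Fin (n + 1) → k)) := by
    rw [injective_iff_map_eq_zero]
    intro v hv
    have hv' : A v = 0 := hv
    have h1 (i) : v (j.succAbove i) = 0 := by rw [← hAs v i, hv']; rfl
    have h2 : v = v j • Pi.single j 1 := by
      ext i
      rcases Fin.eq_self_or_eq_succAbove j i with rfl | ⟨i, rfl⟩
      · simp
      · simp [h1]
    have h3 : v j * fderiv k w x₀ (Pi.single j 1) = 0 := by
      rw [← smul_eq_mul, ← map_smul, ← h2, ← hA0, hv']; rfl
    rw [h2, (mul_eq_zero.1 h3).resolve_right hj, zero_smul]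
  let i : (Fin (n + 1) → k) ≃L[k] (Fin (n + 1) → k) :=
    (LinearEquiv.ofInjectiveEndo _ hinj).toContinuousLinearEquiv
  have hi : (i : (Fin (n + 1) → k) →L[k] (Fin (n + 1) → k)) = A := by
    ext v : 1; rfl
  have hstrict : HasStrictFDerivAt Ψ (i : (Fin (n + 1) → k) →L[k] (Fin (n + 1) → k)) x₀ := by
    rw [hi]; exact hΨ.hasStrictFDerivAt
  let e := hstrict.toOpenPartialHomeomorph Ψ
  have he : ∀ x, e x = Ψ x := fun _ => rfl
  have hx₀ : x₀ ∈ e.source := hstrict.mem_toOpenPartialHomeomorph_source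
  have hsymm : AnalyticAt k e.symm (e x₀) := e.analyticAt_symm' (i := i) hx₀ hΨ hi.symm
  have hG : {z | AnalyticAt k e.symm z ∧ e.symm z ∈ U} ∈ 𝓝 (e x₀) := by
    refine hsymm.eventually_analyticAt.and (hsymm.continuousAt ?_)
    rwa [e.left_inv hx₀]
  refine ⟨e.symm, e.target ∩ interior {z | AnalyticAt k e.symm z ∧ e.symm z ∈ U},
    e.open_target.inter isOpen_interior, fun z hz => (interior_subset hz.2).1,
    fun z hz => (interior_subset hz.2).2, fun z hz => ?_, ?_⟩
  · have h1 : Ψ (e.symm z) = z := by rw [← he, e.right_inv hz.1]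
    exact congrFun h1 0
  · filter_upwards [e.open_source.mem_nhds hx₀,
      (e.continuousAt hx₀).eventually (interior_mem_nhds.2 hG)] with x hx hx'
    exact ⟨e x, ⟨e.map_source hx, hx'⟩, e.left_inv hx⟩

end Analytic

/-! ### The two reductions and the induction -/

section Sard

variable {k : Type*} [NontriviallyNormedField k] [ProperSpace k] [MeasurableSpace k] [BorelSpace k]

/-- Critical points with nonzero differential: by taking a component of `f` as a coordinate and
slicing, the statement reduces to the one for analytic maps `k ^ n → k ^ s`. -/
theorem piHaar_image_critical_fderiv_ne_zero {n s : ℕ}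
    (ih : ∀ (g : (Fin n → k) → (Fin s → k)) (V : Set (Fin n → k)), IsOpen V →
      AnalyticOnNhd k g V → piHaar k s (g '' {x ∈ V | ¬ Function.Surjective (fderiv k g x)}) = 0)
    {f : (Fin (n + 1) → k) → (Fin (s + 1) → k)} {U : Set (Fin (n + 1) → k)} (hU : IsOpen U)
    (hf : AnalyticOnNhd k f U) :
    piHaar k (s + 1)
      (f '' {x ∈ U | ¬ Function.Surjective (fderiv k f x) ∧ fderiv k f x ≠ 0}) = 0 := by
  refine measure_image_null_of_locally fun x₀ hx₀ => ?_
  obtain ⟨hx₀U, -, hne⟩ := hx₀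
  have hcomp (x) (hx : x ∈ U) (l : Fin (s + 1)) : HasFDerivAt (fun x => f x l)
      ((ContinuousLinearMap.proj l).comp (fderiv k f x)) x :=
    hasFDerivAt_pi'.1 (hf x hx).differentiableAt.hasFDerivAt l
  obtain ⟨l, hl⟩ : ∃ l, fderiv k (fun x => f x l) x₀ ≠ 0 := by
    by_contra! hcon
    refine hne ?_
    ext v l
    have h1 := hcon l
    rw [(hcomp x₀ hx₀U l).fderiv] at h1
    exact congrArg (fun L => L v) h1
  have hw : AnalyticAt k (fun x => f x l) x₀ := analyticAt_pi_iff.1 (hf x₀ hx₀U) l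
  obtain ⟨φ, T, hT, hφ, hφU, hφw, hcov⟩ :=
    exists_analytic_parametrization hw hl (hU.mem_nhds hx₀U)
  refine ⟨_, hcov, ?_⟩
  let g : (Fin (n + 1) → k) → (Fin (s + 1) → k) := fun z => f (φ z)
  have hg : AnalyticOnNhd k g T := fun z hz => (hf _ (hφU hz)).comp (hφ z hz)
  have hO : IsOpen (T ∩ fderiv k g ⁻¹' {L | Function.Surjective L}) :=
    hg.fderiv.continuousOn.isOpen_inter_preimage hT isOpen_setOf_surjective_continuousLinearMap
  -- Enlarging to the whole critical set of `g` on `T` gives a Borel image, as Fubini requires.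
  have hsub : f '' ({x ∈ U | ¬ Function.Surjective (fderiv k f x) ∧ fderiv k f x ≠ 0} ∩
      {x | ∃ z ∈ T, φ z = x}) ⊆
      g '' (T \ (T ∩ fderiv k g ⁻¹' {L | Function.Surjective L})) := by
    rintro _ ⟨_, ⟨⟨hxU, hns, -⟩, z, hz, rfl⟩, rfl⟩
    refine ⟨z, ⟨hz, fun hz' => hns ?_⟩, rfl⟩
    have h1 : fderiv k g z = (fderiv k f (φ z)).comp (fderiv k φ z) :=
      fderiv_comp z (hf _ hxU).differentiableAt (hφ z hz).differentiableAt
    have h2 : Function.Surjective (fderiv k g z) := hz'.2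
    rw [h1] at h2
    exact Function.Surjective.of_comp h2
  refine measure_mono_null hsub (piHaar_eq_zero_of_slices l
    (measurableSet_image_sdiff_of_isOpen hT hO hg.continuousOn) fun c => ?_)
  -- On the slice `z 0 = c` component `l` of `g` is constantly `c`, so it is dropped.
  let h : (Fin n → k) → (Fin s → k) := fun y i => g (Fin.cons c y) (l.succAbove i)
  have hV : IsOpen ((fun y : Fin n → k => (Fin.cons c y : Fin (n + 1) → k)) ⁻¹' T) :=
    hT.preimage (continuous_iff_continuousAt.2 fun y => (analyticAt_finCons c y).continuousAt)
  refine measure_mono_null ?_ (ih h _ hV fun y hy => analyticAt_pi_iff.2 fun i =>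
    analyticAt_pi_iff.1
      ((hg (Fin.cons c y) hy).comp (analyticAt_finCons c y)) (l.succAbove i))
  rintro y ⟨z, ⟨hz, hzO⟩, hzy⟩
  have hz0 : z 0 = c := by
    rw [← hφw z hz]
    change g z l = c
    rw [hzy]
    simp
  have hzc : z = Fin.cons c (Fin.tail z) := by rw [← hz0, Fin.cons_self_tail]
  have hval : h (Fin.tail z) = y := by
    ext i
    change g (Fin.cons c (Fin.tail z)) (l.succAbove i) = y i
    rw [← hzc, hzy, Fin.insertNth_apply_succAbove]
  refine ⟨Fin.tail z, ⟨by rw [mem_preimage, ← hzc]; exact hz, fun hsurj => hzO ⟨hz, ?_⟩⟩, hval⟩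
  have hgd : HasFDerivAt g (fderiv k g z) z := (hg z hz).differentiableAt.hasFDerivAt
  have hgl (v) : fderiv k g z v l = v 0 := by
    have h1 : HasFDerivAt (fun z => g z l) ((ContinuousLinearMap.proj l).comp (fderiv k g z)) z :=
      hasFDerivAt_pi'.1 hgd l
    have h2 : HasFDerivAt (fun z => g z l)
        (ContinuousLinearMap.proj (R := k) (φ := fun _ : Fin (n + 1) => k) 0) z := by
      refine HasFDerivAt.congr_of_eventuallyEq
        (ContinuousLinearMap.proj (R := k) (φ := fun _ : Fin (n + 1) => k) 0).hasFDerivAt ?_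
      filter_upwards [hT.mem_nhds hz] with z hz
      exact hφw z hz
    exact congrArg (fun L => L v) (h1.unique h2)
  have hhd (v : Fin n → k) (i : Fin s) :
      fderiv k h (Fin.tail z) v i = fderiv k g z (consZeroL k n v) (l.succAbove i) := by
    have h1 : HasFDerivAt (fun y => g (Fin.cons c y)) ((fderiv k g z).comp (consZeroL k n))
        (Fin.tail z) := by
      refine HasFDerivAt.comp (g := g) (Fin.tail z) ?_ (hasFDerivAt_finCons_const c (Fin.tail z))
      rw [← hzc]
      exact hgd
    have h2 : HasFDerivAt h (ContinuousLinearMap.pi fun i =>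
        (ContinuousLinearMap.proj (l.succAbove i)).comp ((fderiv k g z).comp (consZeroL k n)))
        (Fin.tail z) :=
      hasFDerivAt_pi.2 fun i => hasFDerivAt_pi'.1 h1 (l.succAbove i)
    rw [h2.fderiv]
    rfl
  -- Row `l` of `dg` is the first coordinate, so `dg` is block triangular with remaining block `dh`:
  -- choose the first coordinate `u l`, then solve for the rest.
  change Function.Surjective (fderiv k g z)
  intro u
  obtain ⟨v, hv⟩ := hsurj fun i => u (l.succAbove i) -
    fderiv k g z (Fin.cons (u l) 0) (l.succAbove i)
  refine ⟨Fin.cons (u l) v, ?_⟩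
  ext i
  rcases Fin.eq_self_or_eq_succAbove l i with rfl | ⟨i, rfl⟩
  · rw [hgl, Fin.cons_zero]
  · have h1 := congrFun hv i
    rw [hhd] at h1
    rw [cons_eq_consZeroL_add, map_add, Pi.add_apply, h1, sub_add_cancel]

/-- Points where the derivatives of orders `1` and `i` vanish but that of order `i + 1` does not lie
locally on an analytic hypersurface, so that the statement reduces to the one for analytic maps
`k ^ n → k ^ r`. -/
theorem piHaar_image_iteratedFDeriv_eq_zero_succ_ne_zero {n r i : ℕ} (hr : 0 < r)
    (ih : ∀ (g : (Fin n → k) → (Fin r → k)) (V : Set (Fin n → k)), IsOpen V →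
      AnalyticOnNhd k g V → piHaar k r (g '' {x ∈ V | ¬ Function.Surjective (fderiv k g x)}) = 0)
    {f : (Fin (n + 1) → k) → (Fin r → k)} {U : Set (Fin (n + 1) → k)} (hU : IsOpen U)
    (hf : AnalyticOnNhd k f U) :
    piHaar k r (f '' {x ∈ U | fderiv k f x = 0 ∧ iteratedFDeriv k i f x = 0 ∧
      iteratedFDeriv k (i + 1) f x ≠ 0}) = 0 := by
  refine measure_image_null_of_locally fun x₀ hx₀ => ?_
  obtain ⟨hx₀U, -, -, hne⟩ := hx₀
  obtain ⟨M, hM⟩ : ∃ M, iteratedFDeriv k (i + 1) f x₀ M ≠ 0 := by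
    by_contra! hcon
    exact hne (ContinuousMultilinearMap.ext hcon)
  rw [iteratedFDeriv_succ_apply_left] at hM
  obtain ⟨l, hl⟩ := Function.ne_iff.1 hM
  -- An entry of the `i`-th derivative whose derivative along `M 0` is nonzero at `x₀`; its zero
  -- locus is the hypersurface.
  let Λ : ((Fin (n + 1) → k) [×i]→L[k] (Fin r → k)) →L[k] k :=
    (ContinuousLinearMap.proj l).comp
      (ContinuousMultilinearMap.apply k (fun _ : Fin i => Fin (n + 1) → k) (Fin r → k)
        (Fin.tail M))
  have hD : AnalyticAt k (iteratedFDeriv k i f) x₀ := hf.iteratedFDeriv i x₀ hx₀U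
  let w : (Fin (n + 1) → k) → k := fun x => Λ (iteratedFDeriv k i f x)
  have hw : AnalyticAt k w x₀ := (Λ.analyticAt _).comp hD
  have hdw : fderiv k w x₀ ≠ 0 := by
    have h1 : HasFDerivAt w (Λ.comp (fderiv k (iteratedFDeriv k i f) x₀)) x₀ :=
      Λ.hasFDerivAt.comp x₀ hD.differentiableAt.hasFDerivAt
    rw [h1.fderiv]
    exact fun h0 => hl (congrArg (fun L => L (M 0)) h0)
  obtain ⟨φ, T, hT, hφ, hφU, hφw, hcov⟩ :=
    exists_analytic_parametrization hw hdw (hU.mem_nhds hx₀U)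
  refine ⟨_, hcov, ?_⟩
  have hV : IsOpen ((fun y : Fin n → k => (Fin.cons 0 y : Fin (n + 1) → k)) ⁻¹' T) :=
    hT.preimage (continuous_iff_continuousAt.2 fun y => (analyticAt_finCons 0 y).continuousAt)
  have hψ (y : Fin n → k) (hy : (Fin.cons 0 y : Fin (n + 1) → k) ∈ T) :
      AnalyticAt k (fun y : Fin n → k => φ (Fin.cons 0 y)) y :=
    AnalyticAt.comp (hφ (Fin.cons 0 y) hy) (analyticAt_finCons 0 y)
  refine measure_mono_null ?_ (ih (fun y => f (φ (Fin.cons 0 y))) _ hV fun y hy =>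
    AnalyticAt.comp (hf _ (hφU hy)) (hψ y hy))
  rintro _ ⟨_, ⟨⟨hxU, hd, hi0, -⟩, z, hz, rfl⟩, rfl⟩
  have hz0 : z 0 = 0 := by
    rw [← hφw z hz]
    change Λ (iteratedFDeriv k i f (φ z)) = 0
    rw [hi0, map_zero]
  have hzc : Fin.cons 0 (Fin.tail z) = z := by rw [← hz0, Fin.cons_self_tail]
  have hy : (Fin.cons 0 (Fin.tail z) : Fin (n + 1) → k) ∈ T := by rw [hzc]; exact hz
  refine ⟨Fin.tail z, ⟨hy, ?_⟩, by simp only [hzc]⟩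
  have h1 : fderiv k (fun y => f (φ (Fin.cons 0 y))) (Fin.tail z) = 0 := by
    have h2 := fderiv_comp (𝕜 := k) (g := f) (f := fun y : Fin n → k => φ (Fin.cons 0 y))
      (Fin.tail z) (hf _ (hφU hy)).differentiableAt (hψ _ hy).differentiableAt
    have h3 : fderiv k f (φ (Fin.cons 0 (Fin.tail z))) = 0 := by rw [hzc, hd]
    rw [h3, ContinuousLinearMap.zero_comp] at h2
    exact h2
  rw [h1]
  intro hs
  obtain ⟨v, hv⟩ := hs fun _ => 1
  exact zero_ne_one (congrFun hv ⟨0, hr⟩)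

/-- Sard's theorem for analytic maps between open subsets of `k ^ m` and `k ^ r`. -/
theorem piHaar_image_critical_eq_zero [IsUltrametricDist k] {p : ℕ} (hp : p.Prime) [CharP k p]
    {m : ℕ} : ∀ {r : ℕ}, m + 1 < p + r → ∀ (f : (Fin m → k) → (Fin r → k)) (U : Set (Fin m → k)),
      IsOpen U → AnalyticOnNhd k f U →
        piHaar k r (f '' {x ∈ U | ¬ Function.Surjective (fderiv k f x)}) = 0 := by
  induction m with
  | zero =>
    intro r _ f U _ hf
    rcases Nat.eq_zero_or_pos r with rfl | hr
    · have : {x ∈ U | ¬ Function.Surjective (fderiv k f x)} = ∅ :=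
        eq_empty_of_forall_notMem fun x hx => hx.2 (Function.surjective_to_subsingleton _)
      rw [this, image_empty, measure_empty]
    · refine piHaar_image_eq_zero_of_isBigO (d := 1) (by omega) fun x hx => ?_
      simp
  | succ n ih =>
    intro r hmr f U hU hf
    rcases lt_or_ge (n + 1) r with hlt | hge
    · refine piHaar_image_eq_zero_of_isBigO (d := 1) (by omega) fun x hx => ?_
      simpa using (hf x hx.1).differentiableAt.isBigO_sub.norm_right
    rcases r with _ | s
    · have : {x ∈ U | ¬ Function.Surjective (fderiv k f x)} = ∅ :=
        eq_empty_of_forall_notMem fun x hx => hx.2 (Function.surjective_to_subsingleton _)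
      rw [this, image_empty, measure_empty]
    -- Slicing preserves the difference of dimensions; passing to a hypersurface lowers it by one.
    -- Both keep the bound on `p`.
    have hrank := piHaar_image_critical_fderiv_ne_zero (ih (r := s) (by omega)) hU hf
    have hmid (i : ℕ) := piHaar_image_iteratedFDeriv_eq_zero_succ_ne_zero (r := s + 1) (i := i + 1)
      (Nat.succ_pos s) (ih (by omega)) hU hf
    have hflat : piHaar k (s + 1)
        (f '' {x ∈ U | ∀ i, 1 ≤ i → i < p → iteratedFDeriv k i f x = 0}) = 0 := by
      refine piHaar_image_eq_zero_of_isBigO (d := p) ?_ fun x hx =>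
        (hf x hx.1).isBigO_sub_pow_of_iteratedFDeriv_eq_zero hp hx.2
      obtain ⟨q, hq⟩ := Nat.exists_eq_add_of_le hge
      have h1 : q + 2 ≤ p := by omega
      have h2 : (q + 2) * (s + 1) ≤ p * (s + 1) := Nat.mul_le_mul_right _ h1
      nlinarith [Nat.zero_le (q * s)]
    refine measure_mono_null ?_ (measure_union_null hrank
      (measure_union_null (measure_iUnion_null hmid) hflat))
    rintro _ ⟨x, ⟨hxU, hns⟩, rfl⟩
    by_cases hd : fderiv k f x = 0
    swap
    · exact Or.inl ⟨x, ⟨hxU, hns, hd⟩, rfl⟩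
    refine Or.inr ?_
    have h1 : iteratedFDeriv k 1 f x = 0 := by
      ext v : 1
      rw [iteratedFDeriv_one_apply, hd]
      rfl
    by_cases hall : ∀ i, iteratedFDeriv k (i + 1) f x = 0
    · refine Or.inr ⟨x, ⟨hxU, fun i hi _ => ?_⟩, rfl⟩
      obtain ⟨i, rfl⟩ := Nat.exists_eq_add_of_le' hi
      exact hall i
    · push Not at hall
      classical
      have hspec := Nat.find_spec hall
      have hmin := fun j => Nat.find_min (m := j) hall
      -- Index `j` stands for order `j + 1`. Order one vanishes, so the first surviving order is `i
      -- + 2`.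
      rcases hfind : Nat.find hall with _ | i
      · rw [hfind] at hspec
        exact absurd h1 hspec
      · rw [hfind] at hspec hmin
        refine Or.inl (mem_iUnion.2 ⟨i, x, ⟨hxU, hd, ?_, hspec⟩, rfl⟩)
        simpa using hmin i (Nat.lt_succ_self i)

end Sard

/-! ### From open subsets of `k ^ m` to manifolds -/

theorem isUltrametricDist_of_charP (k : Type*) [NontriviallyNormedField k] {p : ℕ} (hp : 0 < p)
    [CharP k p] : IsUltrametricDist k := by
  refine IsUltrametricDist.isUltrametricDist_of_forall_norm_natCast_le_one fun n => ?_
  by_contra! hn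
  -- the powers of `n` take finitely many values, so their norms are bounded
  have hfin : (range fun j : ℕ => ((n ^ j : ℕ) : k)).Finite := by
    refine ((finite_lt_nat p).image fun i : ℕ => (i : k)).subset ?_
    rintro _ ⟨j, rfl⟩
    refine ⟨n ^ j % p, Nat.mod_lt _ hp, ?_⟩
    exact (CharP.cast_eq_mod k p (n ^ j)).symm
  obtain ⟨C, hC⟩ := hfin.isBounded.exists_norm_le
  obtain ⟨j, hj⟩ := pow_unbounded_of_one_lt C hn
  have hle : ‖((n ^ j : ℕ) : k)‖ ≤ C := hC _ ⟨j, rfl⟩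
  rw [Nat.cast_pow, norm_pow] at hle
  exact absurd hle (not_le.2 hj)

/-- If `f` is critical at `x`, then so is its expression in charts around `x` and `f x`. -/
theorem not_surjective_fderiv_of_mem_criticalSet {k : Type*} [NontriviallyNormedField k]
    {m r : ℕ} {X : Type*} [TopologicalSpace X] [ChartedSpace (Fin m → k) X]
    {Y : Type*} [TopologicalSpace Y] [ChartedSpace (Fin r → k) Y]
    {f : X → Y} {c : OpenPartialHomeomorph X (Fin m → k)} {e : OpenPartialHomeomorph Y (Fin r → k)}
    (hc : c.MDifferentiable 𝓘(k, Fin m → k) 𝓘(k, Fin m → k))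
    (he : e.MDifferentiable 𝓘(k, Fin r → k) 𝓘(k, Fin r → k)) {x : X}
    (hf : MDifferentiableAt 𝓘(k, Fin m → k) 𝓘(k, Fin r → k) f x)
    (hx : x ∈ c.source) (hfx : f x ∈ e.source) (hcrit : x ∈ criticalSet k m r f) :
    ¬ Function.Surjective (fderiv k (e ∘ f ∘ c.symm) (c x)) := by
  intro hsurj
  refine hcrit ?_
  have hcx : c.symm (c x) = x := c.left_inv hx
  have h1 : HasMFDerivAt 𝓘(k, Fin m → k) 𝓘(k, Fin m → k) c.symm (c x)
      (mfderiv 𝓘(k, Fin m → k) 𝓘(k, Fin m → k) c.symm (c x)) :=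
    (hc.mdifferentiableAt_symm (c.map_source hx)).hasMFDerivAt
  have h2 : HasMFDerivAt 𝓘(k, Fin m → k) 𝓘(k, Fin r → k) f (c.symm (c x))
      (mfderiv 𝓘(k, Fin m → k) 𝓘(k, Fin r → k) f (c.symm (c x))) := by
    refine MDifferentiableAt.hasMFDerivAt ?_
    rwa [hcx]
  have h3 : HasMFDerivAt 𝓘(k, Fin r → k) 𝓘(k, Fin r → k) e ((f ∘ c.symm) (c x))
      (mfderiv 𝓘(k, Fin r → k) 𝓘(k, Fin r → k) e ((f ∘ c.symm) (c x))) := by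
    refine (he.mdifferentiableAt ?_).hasMFDerivAt
    rwa [Function.comp_apply, hcx]
  have h4 := (h3.comp _ (h2.comp _ h1)).mfderiv
  rw [mfderiv_eq_fderiv] at h4
  rw [h4] at hsurj
  have hinj : Function.Injective
      (mfderiv 𝓘(k, Fin r → k) 𝓘(k, Fin r → k) e ((f ∘ c.symm) (c x))) :=
    he.mfderiv_injective (by rwa [Function.comp_apply, hcx])
  have h5 : Function.Surjective
      (mfderiv 𝓘(k, Fin m → k) 𝓘(k, Fin r → k) f (c.symm (c x))) := by
    intro u
    obtain ⟨v, hv⟩ := hsurj (mfderiv 𝓘(k, Fin r → k) 𝓘(k, Fin r → k) e ((f ∘ c.symm) (c x)) u)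
    exact ⟨_, hinj hv⟩
  rw [hcx] at h5
  exact h5

theorem theorem2p5
    {k : Type*} [NontriviallyNormedField k] [LocallyCompactSpace k]
    [MeasurableSpace k] [BorelSpace k]
    {p : ℕ} (hp : 0 < p) [CharP k p]
    {m r : ℕ}
    {X : Type*} [TopologicalSpace X] [SecondCountableTopology X]
    [ChartedSpace (Fin m → k) X] [IsManifold 𝓘(k, Fin m → k) ω X]
    {Y : Type*} [TopologicalSpace Y] [SecondCountableTopology Y]
    [ChartedSpace (Fin r → k) Y] [IsManifold 𝓘(k, Fin r → k) ω Y]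
    (f : X → Y) (hf : ContMDiff 𝓘(k, Fin m → k) 𝓘(k, Fin r → k) ω f)
    (hpmr : (m : ℤ) - (r : ℤ) + 1 < (p : ℤ)) :
    HasMeasureZero k r (f '' criticalSet k m r f) := by
  intro e he μ hμ
  have : ProperSpace k := ProperSpace.of_locallyCompactSpace k
  have : IsUltrametricDist k := isUltrametricDist_of_charP k hp
  have hprime : p.Prime := (CharP.char_is_prime_or_zero k p).resolve_right hp.ne'
  -- Haar measures share their null sets, so the product measure suffices.
  have hac : μ ≪ piHaar k r := Measure.absolutelyContinuous_isAddHaarMeasure μ (piHaar k r)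
  refine hac ?_
  have hset : e '' (f '' criticalSet k m r f ∩ e.source) ⊆
      (e ∘ f) '' (criticalSet k m r f ∩ f ⁻¹' e.source) := by
    rintro _ ⟨_, ⟨⟨x, hx, rfl⟩, hxe⟩, rfl⟩
    exact ⟨x, ⟨hx, hxe⟩, rfl⟩
  -- Second countability of `X` reduces the claim to a single chart domain.
  refine measure_mono_null hset (measure_image_null_of_locally fun x₀ _ => ?_)
  let c := chartAt (Fin m → k) x₀
  have hcmax : c ∈ IsManifold.maximalAtlas 𝓘(k, Fin m → k) ω X :=
    IsManifold.chart_mem_maximalAtlas x₀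
  refine ⟨c.source, c.open_source.mem_nhds (mem_chart_source _ x₀), ?_⟩
  have hcsymm := contMDiffOn_symm_of_mem_maximalAtlas hcmax
  have heω := contMDiffOn_of_mem_maximalAtlas he
  have hcd : c.MDifferentiable 𝓘(k, Fin m → k) 𝓘(k, Fin m → k) :=
    ⟨(contMDiffOn_of_mem_maximalAtlas hcmax).mdifferentiableOn (by simp),
      hcsymm.mdifferentiableOn (by simp)⟩
  have hed : e.MDifferentiable 𝓘(k, Fin r → k) 𝓘(k, Fin r → k) :=
    ⟨heω.mdifferentiableOn (by simp),
      (contMDiffOn_symm_of_mem_maximalAtlas he).mdifferentiableOn (by simp)⟩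
  let W : Set (Fin m → k) := c.target ∩ c.symm ⁻¹' (f ⁻¹' e.source)
  have hW : IsOpen W := c.symm.isOpen_inter_preimage (e.open_source.preimage hf.continuous)
  have hg : AnalyticOnNhd k (e ∘ f ∘ c.symm) W := by
    rw [← hW.analyticOn_iff_analyticOnNhd, ← contDiffOn_omega_iff_analyticOn hW.uniqueDiffOn,
      ← contMDiffOn_iff_contDiffOn]
    exact heω.comp (hf.comp_contMDiffOn (hcsymm.mono inter_subset_left)) fun z hz => hz.2
  refine measure_mono_null ?_
    (piHaar_image_critical_eq_zero hprime (by omega) (e ∘ f ∘ c.symm) W hW hg)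
  rintro _ ⟨x, ⟨⟨hx, hxe⟩, hxc⟩, rfl⟩
  have hcx : c.symm (c x) = x := c.left_inv hxc
  refine ⟨c x, ⟨⟨c.map_source hxc, ?_⟩, ?_⟩, ?_⟩
  · rw [mem_preimage, hcx]
    exact hxe
  · exact not_surjective_fderiv_of_mem_criticalSet hcd hed (hf.mdifferentiableAt (by simp))
      hxc hxe hx
  · simp only [Function.comp_apply, hcx]
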